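/- Let $G$ be a simple graph, and let $P$ be a path of length three in $G$ (that is, with three edges and four distinct vertices) whose two internal vertices have degree two in $G$ and whose two end vertices are not adjacent in $G$. Let $G/P$ be the simple graph obtained from $G$ by contracting $P$ to a single new vertex $p$; thus $p$ is adjacent to exactly those vertices outside $P$ that have a neighbour on $P$, and the adjacencies among the vertices outside $P$ are unchanged. For a graph $H$, let $\mathrm{Ind}(H)$ be the simplicial complex whose faces are the finite independent sets of $H$, and for a simplicial complex $\Delta$ let $\mathrm{susp}(\Delta)$ be its unreduced suspension, i.e. the join of $\Delta$ with two points. Then (the geometric realization of) $\mathrm{Ind}(G)$ is homotopy equivalent to (the geometric realization of) $\mathrm{susp}(\mathrm{Ind}(G/P))$. -/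

import Mathlib

open scoped ContinuousMap

/-- The geometric realization of an abstract simplicial complex: convex combinations of the
vertices (barycentric coordinates) that are supported on a face. -/
@[ext]
structure SimplicialRealization {V : Type*} (K : PreAbstractSimplicialComplex V) where
  weight : V →₀ ℝ
  nonneg : ∀ v, 0 ≤ weight v
  sum_eq_one : ∑ v ∈ weight.support, weight v = 1
  support_mem : weight.support ∈ K.faces

namespace SimplicialRealization

open Classical in
/-- The closed geometric simplex of `K` spanned by the face `s`. -/
noncomputable def simplexMap {V : Type*} (K : PreAbstractSimplicialComplex V) (s : K.faces)
    (x : stdSimplex ℝ (s : Finset V)) : SimplicialRealization K :=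
  let w : V →₀ ℝ := Finsupp.onFinset (s : Finset V)
    (fun v => if h : v ∈ (s : Finset V) then x.1 ⟨v, h⟩ else 0)
    (fun v hv => by by_contra h; simp [h] at hv)
  have hsub : w.support ⊆ (s : Finset V) := Finsupp.support_onFinset_subset
  have hsum : ∑ v ∈ w.support, w v = 1 := by
    rw [Finset.sum_subset hsub (fun v _ hv => Finsupp.notMem_support_iff.mp hv), ← x.2.2,
      ← Finset.sum_coe_sort]
    refine Finset.sum_congr rfl fun v _ => ?_
    simp [w]
  { weight := w
    nonneg := fun v => by
      change 0 ≤ (if h : v ∈ (s : Finset V) then x.1 ⟨v, h⟩ else 0)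
      split_ifs with h
      · exact x.2.1 ⟨v, h⟩
      · exact le_rfl
    sum_eq_one := hsum
    support_mem := (K.isRelLowerSet_faces s.2).2 hsub (by
      rw [Finset.nonempty_iff_ne_empty]
      intro h
      rw [h, Finset.sum_empty] at hsum
      exact zero_ne_one hsum) }

/-- The weak (coherent) topology: a set is open if and only if its trace on every closed simplex is
open. If there are finitely many vertices, this is the Euclidean topology. -/
noncomputable instance instTopologicalSpace {V : Type*} (K : PreAbstractSimplicialComplex V) :
    TopologicalSpace (SimplicialRealization K) :=
  ⨆ s : K.faces, TopologicalSpace.coinduced (simplexMap K s) inferInstance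

end SimplicialRealization

namespace PreAbstractSimplicialComplex

/-- The join of two simplicial complexes with disjoint vertex sets: its faces are the nonempty
unions of a face (or the empty set) of `K` and a face (or the empty set) of `L`. -/
def join {V W : Type*} (K : PreAbstractSimplicialComplex V) (L : PreAbstractSimplicialComplex W) :
    PreAbstractSimplicialComplex (V ⊕ W) where
  faces := {s | s.Nonempty ∧ (s.toLeft = ∅ ∨ s.toLeft ∈ K.faces) ∧
    (s.toRight = ∅ ∨ s.toRight ∈ L.faces)}
  isRelLowerSet_faces := by
    rintro s ⟨hs, hl, hr⟩
    refine ⟨hs, fun t hts ht => ⟨ht, ?_, ?_⟩⟩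
    · have hsub : t.toLeft ⊆ s.toLeft := Finset.toLeft_subset_toLeft hts
      rcases t.toLeft.eq_empty_or_nonempty with h | h
      · exact Or.inl h
      · rcases hl with hl | hl
        · exact Or.inl (Finset.subset_empty.mp (hl ▸ hsub))
        · exact Or.inr ((K.isRelLowerSet_faces hl).2 hsub h)
    · have hsub : t.toRight ⊆ s.toRight := Finset.toRight_subset_toRight hts
      rcases t.toRight.eq_empty_or_nonempty with h | h
      · exact Or.inl h
      · rcases hr with hr | hr
        · exact Or.inl (Finset.subset_empty.mp (hr ▸ hsub))
        · exact Or.inr ((L.isRelLowerSet_faces hr).2 hsub h)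

/-- The complex that consists of two isolated vertices (the sphere of dimension zero). -/
def twoPoints : PreAbstractSimplicialComplex Bool where
  faces := {s | s.card = 1}
  isRelLowerSet_faces := by
    intro s hs
    rw [Set.mem_ofPred_eq] at hs
    refine ⟨Finset.card_pos.mp (by omega), fun t hts ht => ?_⟩
    have h1 := Finset.card_le_card hts
    have h2 := Finset.card_pos.mpr ht
    change t.card = 1
    omega

/-- The (unreduced) suspension of a simplicial complex: its join with two points. -/
def suspension {V : Type*} (K : PreAbstractSimplicialComplex V) :
    PreAbstractSimplicialComplex (Bool ⊕ V) :=
  twoPoints.join K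

end PreAbstractSimplicialComplex

namespace SimpleGraph

/-- The independence complex of a graph: its faces are the nonempty finite independent sets. -/
def independenceComplex {V : Type*} (G : SimpleGraph V) : PreAbstractSimplicialComplex V where
  faces := {s | s.Nonempty ∧ G.IsIndepSet (s : Set V)}
  isRelLowerSet_faces := fun _ hs =>
    ⟨hs.1, fun _ hts ht => ⟨ht, hs.2.mono (Finset.coe_subset.mpr hts)⟩⟩

open Classical in
/-- The map of vertices that sends the vertices of `H` to the new point `none` and fixes every
other vertex. -/
noncomputable def contractMap {V : Type*} {G : SimpleGraph V} (H : G.Subgraph) (v : V) :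
    Option {v : V // v ∉ H.verts} :=
  if h : v ∈ H.verts then none else some ⟨v, h⟩

/-- The contraction `G / H` of a subgraph `H` to a new point, as a simple graph: distinct vertices
are adjacent if and only if some preimages of them are adjacent in `G`. -/
noncomputable def contract {V : Type*} (G : SimpleGraph V) (H : G.Subgraph) :
    SimpleGraph (Option {v : V // v ∉ H.verts}) :=
  G.map (contractMap H)

end SimpleGraph

/-!
Write the path as `a - b - c - d`, and let `U` be the set of the other vertices. Since `b` and `c`
have no neighbors in `U`, an independent set of `G` is the union of an independent set of `U` and
an independent subset of the path; the latter ones form the complex `c - a - d - b`, and those that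
contain `a` or `d` may only be combined with sets that avoid the neighbors of `a` or `d`. In the
suspension of `Ind (G / P)` with poles `N` and `S`, the path `c - a - d - b` is replaced by
`N - p - S`, and the sets that contain `p` are combined with the sets that avoid the neighbors of
both `a` and `d`. So subdividing the edge `{a, d}` at its midpoint `p` and contracting the edges
`{c, a}` to `N` and `{d, b}` to `S` turns `Ind G` into the suspension.

The proof makes this explicit by piecewise linear maps `IsThreePath.toSuspension` and
`IsThreePath.ofSuspension`. The tool for homotopies is `homotopic_of_union_mem_faces`: two maps are
homotopic along straight segments if their values at every point lie in a common closed simplex.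
For `toSuspension ∘ ofSuspension` and the identity this applies directly. The composite
`ofSuspension ∘ toSuspension` stretches the edge `{a, d}` over the whole path `c - a - d - b`, which
is not carried by simplices that contain the point; hence the detour over the map
`IsThreePath.stretch`, which stretches the middle half of the edge `{a, d}` over that edge. It
shares simplices with the identity on one side and with the composite on the other.

As the vertex set may be infinite, continuity refers to the weak topology. A map is continuous if
its barycentric coordinates are continuous and it sends finite subcomplexes into finite subcomplexes
(`FinitelyCarried.continuous`), because finite subcomplexes carry the Euclidean topology
(`continuous_of_support_subset`).
-/

/-! ### Continuous maps and homotopies between realizations -/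

namespace SimplicialRealization

variable {V W X : Type*} {K : PreAbstractSimplicialComplex V} {L : PreAbstractSimplicialComplex W}
  {M : PreAbstractSimplicialComplex X}

open Classical in
theorem simplexMap_weight_apply (s : K.faces) (x : stdSimplex ℝ (s : Finset V)) (v : V) :
    (simplexMap K s x).weight v = if h : v ∈ (s : Finset V) then x.1 ⟨v, h⟩ else 0 :=
  rfl

theorem support_simplexMap_subset (s : K.faces) (x : stdSimplex ℝ (s : Finset V)) :
    (simplexMap K s x).weight.support ⊆ s := by
  intro v hv
  by_contra h
  simp [simplexMap_weight_apply, h] at hv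

theorem continuous_simplexMap (s : K.faces) : Continuous (simplexMap K s) :=
  continuous_iff_coinduced_le.mpr
    (le_iSup (fun s : K.faces => TopologicalSpace.coinduced (simplexMap K s) inferInstance) s)

theorem continuous_iff_simplexMap {Y : Type*} [TopologicalSpace Y]
    {F : SimplicialRealization K → Y} :
    Continuous F ↔ ∀ s : K.faces, Continuous (F ∘ simplexMap K s) := by
  refine ⟨fun h s => h.comp (continuous_simplexMap s), fun h => ?_⟩
  exact continuous_iSup_dom.mpr fun s => continuous_coinduced_dom.mpr (h s)

theorem continuous_weight (v : V) :
    Continuous fun x : SimplicialRealization K => x.weight v := by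
  refine continuous_iff_simplexMap.mpr fun s => ?_
  by_cases h : v ∈ (s : Finset V)
  · simpa [Function.comp_def, simplexMap_weight_apply, h] using
      (continuous_apply (⟨v, h⟩ : (s : Finset V))).comp continuous_subtype_val
  · simpa [Function.comp_def, simplexMap_weight_apply, h] using continuous_const

theorem sum_weight_of_support_subset (x : SimplicialRealization K) {s : Finset V}
    (h : x.weight.support ⊆ s) : ∑ v ∈ s, x.weight v = 1 := by
  rw [← x.sum_eq_one]
  exact (Finset.sum_subset h fun v _ hv => Finsupp.notMem_support_iff.mp hv).symm

/-- The barycentric coordinates of a point of the realization relative to a face that contains its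
support. -/
def toSimplex (x : SimplicialRealization K) (s : Finset V) (h : x.weight.support ⊆ s) :
    stdSimplex ℝ s :=
  ⟨fun v => x.weight v, fun v => x.nonneg v, by
    rw [Finset.sum_coe_sort s fun v => x.weight v]
    exact x.sum_weight_of_support_subset h⟩

theorem simplexMap_toSimplex (x : SimplicialRealization K) (s : K.faces)
    (h : x.weight.support ⊆ s) : simplexMap K s (x.toSimplex s h) = x := by
  ext v
  rw [simplexMap_weight_apply]
  split_ifs with hv
  · rfl
  · exact (Finsupp.notMem_support_iff.mp fun h' => hv (h h')).symm

/-- A finite subcomplex carries the Euclidean topology: it is the union of finitely many closed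
simplices, and each of them has the topology of the standard simplex. -/
theorem continuous_of_support_subset {Y : Type*} [TopologicalSpace Y]
    {F : Y → SimplicialRealization L} (S : Finset W) (hS : ∀ y, (F y).weight.support ⊆ S)
    (hc : ∀ w, Continuous fun y => (F y).weight w) : Continuous F := by
  let ι := {s : L.faces // (s : Finset W) ∈ S.powerset}
  have : Finite ι := Finite.of_injective (fun i : ι => (⟨_, i.2⟩ : S.powerset)) fun i j h => by
    ext1; ext1; exact congrArg (fun t : S.powerset => (t : Finset W)) h
  let A : ι → Set Y := fun i => {y | (F y).weight.support ⊆ (i.1 : Finset W)}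
  have hA : ∀ i, A i = ⋂ w ∈ {w | w ∉ (i.1 : Finset W)}, {y | (F y).weight w = 0} := by
    intro i
    ext y
    simp only [A, Set.mem_ofPred_eq, Set.mem_iInter, Finset.subset_iff, Finsupp.mem_support_iff]
    exact forall_congr' fun w => not_imp_comm
  refine (locallyFinite_of_finite A).continuous ?_ ?_ ?_
  · refine Set.eq_univ_of_forall fun y => Set.mem_iUnion.mpr ?_
    exact ⟨⟨⟨_, (F y).support_mem⟩, Finset.mem_powerset.mpr (hS y)⟩,
      Finset.Subset.refl _⟩
  · intro i
    rw [hA]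
    exact isClosed_biInter fun w _ => isClosed_eq (hc w) continuous_const
  · intro i
    rw [continuousOn_iff_continuous_domRestrict]
    have : Continuous fun y : A i => simplexMap L i.1 ((F y).toSimplex _ y.2) := by
      refine (continuous_simplexMap i.1).comp (Continuous.subtype_mk ?_ _)
      exact continuous_pi fun w => (hc w).comp continuous_subtype_val
    refine this.congr fun y => ?_
    exact simplexMap_toSimplex _ _ _

/-- A map of realizations is finitely carried if it sends every finite subcomplex into a finite
subcomplex. -/
def FinitelyCarried (F : SimplicialRealization K → SimplicialRealization L) : Prop :=
  ∀ s : Finset V, ∃ S : Finset W, ∀ x, x.weight.support ⊆ s → (F x).weight.support ⊆ S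

theorem FinitelyCarried.of_support_subset {F : SimplicialRealization K → SimplicialRealization K}
    (h : ∀ x, (F x).weight.support ⊆ x.weight.support) : FinitelyCarried F :=
  fun s => ⟨s, fun x hx => (h x).trans hx⟩

theorem FinitelyCarried.comp {F : SimplicialRealization L → SimplicialRealization M}
    {E : SimplicialRealization K → SimplicialRealization L}
    (hF : FinitelyCarried F) (hE : FinitelyCarried E) : FinitelyCarried (F ∘ E) := fun s =>
  let ⟨S, hS⟩ := hE s
  let ⟨T, hT⟩ := hF S
  ⟨T, fun x hx => hT _ (hS x hx)⟩

theorem FinitelyCarried.continuous {F : SimplicialRealization K → SimplicialRealization L}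
    (hF : FinitelyCarried F) (hc : ∀ w, Continuous fun x => (F x).weight w) : Continuous F := by
  refine continuous_iff_simplexMap.mpr fun s => ?_
  obtain ⟨S, hS⟩ := hF s
  exact continuous_of_support_subset S (fun x => hS _ (support_simplexMap_subset s x))
    fun w => (hc w).comp (continuous_simplexMap s)

theorem degree_weight_eq_one (x : SimplicialRealization K) : x.weight.degree = 1 :=
  x.sum_eq_one

theorem support_nonempty_of_degree {w : V →₀ ℝ} (h : w.degree = 1) : w.support.Nonempty := by
  rw [Finset.nonempty_iff_ne_empty]
  intro h0
  rw [Finsupp.support_eq_empty.mp h0, map_zero] at h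
  exact zero_ne_one h

open Classical in
/-- The point that divides the segment from `x` to `y` in the ratio `t : 1 - t`, for two points that
lie in a common closed simplex. -/
noncomputable def segment (x y : SimplicialRealization K)
    (h : x.weight.support ∪ y.weight.support ∈ K.faces) (t : unitInterval) :
    SimplicialRealization K :=
  have hdeg : ((1 - t : ℝ) • x.weight + (t : ℝ) • y.weight).degree = 1 := by
    have hsmul : ∀ (r : ℝ) (w : V →₀ ℝ), (r • w).degree = r * w.degree := fun r w => by
      rw [Finsupp.degree_apply, Finsupp.degree_apply, Finset.mul_sum]
      exact Finset.sum_subset Finsupp.support_smul fun v _ hv => Finsupp.notMem_support_iff.mp hv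
    rw [map_add, hsmul, hsmul, degree_weight_eq_one, degree_weight_eq_one]
    ring
  { weight := (1 - t : ℝ) • x.weight + (t : ℝ) • y.weight
    nonneg := fun v => add_nonneg (mul_nonneg (sub_nonneg.mpr t.2.2) (x.nonneg v))
      (mul_nonneg t.2.1 (y.nonneg v))
    sum_eq_one := hdeg
    support_mem := (K.isRelLowerSet_faces h).2
      (Finsupp.support_add.trans
        (Finset.union_subset_union Finsupp.support_smul Finsupp.support_smul))
      (support_nonempty_of_degree hdeg) }

open Classical in
/-- Two finitely carried maps whose values at every point lie in a common closed simplex are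
homotopic along straight segments. Joint continuity can be checked simplex by simplex, because
`K × [0, 1]` carries the weak topology as well: the interval is locally compact. -/
theorem homotopic_of_union_mem_faces
    (F₀ F₁ : C(SimplicialRealization K, SimplicialRealization L))
    (h₀ : FinitelyCarried F₀) (h₁ : FinitelyCarried F₁)
    (h : ∀ x, (F₀ x).weight.support ∪ (F₁ x).weight.support ∈ L.faces) :
    F₀.Homotopic F₁ := by
  let H : SimplicialRealization K → unitInterval → SimplicialRealization L :=
    fun x t => segment (F₀ x) (F₁ x) (h x) t
  have hH : ∀ s : K.faces, Continuous fun p : stdSimplex ℝ (s : Finset V) × unitInterval =>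
      H (simplexMap K s p.1) p.2 := by
    intro s
    obtain ⟨S₀, hS₀⟩ := h₀ s
    obtain ⟨S₁, hS₁⟩ := h₁ s
    refine continuous_of_support_subset (S₀ ∪ S₁) (fun p => ?_) fun w => ?_
    · exact Finsupp.support_add.trans (Finset.union_subset_union
        (Finsupp.support_smul.trans (hS₀ _ (support_simplexMap_subset s _)))
        (Finsupp.support_smul.trans (hS₁ _ (support_simplexMap_subset s _))))
    · have hF : ∀ F : C(SimplicialRealization K, SimplicialRealization L),
          Continuous fun p : stdSimplex ℝ (s : Finset V) × unitInterval =>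
            (F (simplexMap K s p.1)).weight w := fun F =>
        (continuous_weight w).comp (F.continuous.comp ((continuous_simplexMap s).comp
          continuous_fst))
      have ht : Continuous fun p : stdSimplex ℝ (s : Finset V) × unitInterval => (p.2 : ℝ) :=
        continuous_subtype_val.comp continuous_snd
      exact ((continuous_const.sub ht).mul (hF F₀)).add (ht.mul (hF F₁))
  have hHx : ∀ x, Continuous (H x) := fun x => by
    have := (hH ⟨_, x.support_mem⟩).comp
      (Continuous.prodMk_right (x.toSimplex x.weight.support subset_rfl))
    have hx : simplexMap K ⟨_, x.support_mem⟩ (x.toSimplex x.weight.support subset_rfl) = x :=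
      simplexMap_toSimplex _ _ _
    refine this.congr fun t => ?_
    change H (simplexMap K ⟨_, x.support_mem⟩ (x.toSimplex x.weight.support subset_rfl)) t = H x t
    rw [hx]
  let Hc : SimplicialRealization K → C(unitInterval, SimplicialRealization L) :=
    fun x => ⟨H x, hHx x⟩
  have hHc : Continuous Hc := by
    refine continuous_iff_simplexMap.mpr fun s => ?_
    apply ContinuousMap.continuous_of_continuous_uncurry
    exact hH s
  have hev : Continuous fun p : unitInterval × SimplicialRealization K => Hc p.2 p.1 :=
    (hHc.comp continuous_snd).eval continuous_fst
  refine ⟨⟨⟨fun p => Hc p.2 p.1, hev⟩, fun x => ?_, fun x => ?_⟩⟩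
  · ext v
    change (1 - (0 : ℝ)) * (F₀ x).weight v + 0 * (F₁ x).weight v = _
    ring
  · ext v
    change (1 - (1 : ℝ)) * (F₀ x).weight v + 1 * (F₁ x).weight v = _
    ring

theorem homotopic_id_of_support_subset (F : C(SimplicialRealization K, SimplicialRealization K))
    (h : ∀ x, (F x).weight.support ⊆ x.weight.support) :
    F.Homotopic (ContinuousMap.id _) := by
  classical
  refine homotopic_of_union_mem_faces _ _ (.of_support_subset h)
    (.of_support_subset fun x => Finset.Subset.refl _) fun x => ?_
  rw [ContinuousMap.id_apply, Finset.union_eq_right.mpr (h x)]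
  exact x.support_mem

end SimplicialRealization

/-! ### Faces of independence complexes and of their suspensions -/

namespace SimpleGraph

variable {V : Type*} {G : SimpleGraph V}

theorem mem_faces_independenceComplex {s : Finset V} :
    s ∈ G.independenceComplex.faces ↔ s.Nonempty ∧ ∀ u ∈ s, ∀ v ∈ s, ¬ G.Adj u v :=
  and_congr_right fun _ => ⟨fun h _ hu _ hv huv => h hu hv huv.ne huv,
    fun h u hu v hv _ => h u hu v hv⟩

theorem mem_faces_suspension_independenceComplex {s : Finset (Bool ⊕ V)} :
    s ∈ G.independenceComplex.suspension.faces ↔ s.Nonempty ∧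
      ¬ (Sum.inl true ∈ s ∧ Sum.inl false ∈ s) ∧
      ∀ u v, Sum.inr u ∈ s → Sum.inr v ∈ s → ¬ G.Adj u v := by
  refine and_congr_right fun _ => and_congr ?_ ?_
  · change s.toLeft = ∅ ∨ s.toLeft.card = 1 ↔ _
    rw [← Finset.card_eq_zero, ← Nat.le_one_iff_eq_zero_or_eq_one, Finset.card_le_one]
    simp only [Finset.mem_toLeft]
    constructor
    · exact fun h hs => Bool.noConfusion (h true hs.1 false hs.2)
    · rintro h (_ | _) hu (_ | _) hv
      exacts [rfl, (h ⟨hv, hu⟩).elim, (h ⟨hu, hv⟩).elim, rfl]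
  · rw [mem_faces_independenceComplex]
    simp only [Finset.mem_toRight]
    constructor
    · rintro (h | h) u v hu hv
      · rw [← Finset.mem_toRight, h] at hu
        exact absurd hu (Finset.notMem_empty u)
      · exact h.2 u hu v hv
    · intro h
      exact s.toRight.eq_empty_or_nonempty.imp_right fun hs => ⟨hs, fun u hu v hv => h u v hu hv⟩

theorem not_adj_of_weight_ne_zero (x : SimplicialRealization G.independenceComplex) {u v : V}
    (hu : x.weight u ≠ 0) (hv : x.weight v ≠ 0) : ¬ G.Adj u v :=
  (mem_faces_independenceComplex.mp x.support_mem).2 u (Finsupp.mem_support_iff.mpr hu) v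
    (Finsupp.mem_support_iff.mpr hv)

theorem weight_eq_zero_or_of_adj (x : SimplicialRealization G.independenceComplex) {u v : V}
    (h : G.Adj u v) : x.weight u = 0 ∨ x.weight v = 0 := by
  by_contra! hx
  exact not_adj_of_weight_ne_zero x hx.1 hx.2 h

theorem weight_pole_eq_zero_or
    (y : SimplicialRealization G.independenceComplex.suspension) :
    y.weight (Sum.inl true) = 0 ∨ y.weight (Sum.inl false) = 0 := by
  by_contra! hy
  exact (mem_faces_suspension_independenceComplex.mp y.support_mem).2.1
    ⟨Finsupp.mem_support_iff.mpr hy.1, Finsupp.mem_support_iff.mpr hy.2⟩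

theorem not_adj_of_weight_inr_ne_zero
    (y : SimplicialRealization G.independenceComplex.suspension) {u v : V}
    (hu : y.weight (Sum.inr u) ≠ 0) (hv : y.weight (Sum.inr v) ≠ 0) : ¬ G.Adj u v :=
  (mem_faces_suspension_independenceComplex.mp y.support_mem).2.2 u v
    (Finsupp.mem_support_iff.mpr hu) (Finsupp.mem_support_iff.mpr hv)

namespace Subgraph

/-! ### Contraction of a path with three edges -/

/-- The vertices of the subgraph `H` are `a`, `b`, `c`, `d`, all distinct; the neighbors of `b` are
`a` and `c`, those of `c` are `b` and `d`, and `a` is not adjacent to `d`. -/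
structure IsThreePath (H : G.Subgraph) (a b c d : V) : Prop where
  mem_verts : ∀ v, v ∈ H.verts ↔ v = a ∨ v = b ∨ v = c ∨ v = d
  hab : a ≠ b
  hac : a ≠ c
  had : a ≠ d
  hbc : b ≠ c
  hbd : b ≠ d
  hcd : c ≠ d
  adj_b : ∀ v, G.Adj b v ↔ v = a ∨ v = c
  adj_c : ∀ v, G.Adj c v ↔ v = b ∨ v = d
  not_adj : ¬ G.Adj a d

variable {H : G.Subgraph} {a b c d : V}

theorem contractMap_eq_some {w : V} {v : {v : V // v ∉ H.verts}} :
    contractMap H w = some v ↔ w = v := by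
  unfold contractMap
  split_ifs with hw
  · exact ⟨False.elim, fun h => (v.2 (h ▸ hw)).elim⟩
  · rw [Option.some_inj, Subtype.ext_iff]

theorem contractMap_eq_none {w : V} : contractMap H w = none ↔ w ∈ H.verts := by
  unfold contractMap
  split_ifs with hw <;> simp [hw]

theorem contract_adj_some {u v : {v : V // v ∉ H.verts}} :
    (G.contract H).Adj (some u) (some v) ↔ G.Adj u v := by
  unfold contract
  rw [map_adj']
  simp only [contractMap_eq_some]
  constructor
  · rintro ⟨_, u', v', h, rfl, rfl⟩
    exact h
  · exact fun h => ⟨fun huv => h.ne (congrArg Subtype.val (Option.some_injective _ huv)), u, v, h,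
      rfl, rfl⟩

theorem IsThreePath.contract_adj_none (hP : H.IsThreePath a b c d) {v : {v : V // v ∉ H.verts}} :
    (G.contract H).Adj none (some v) ↔ G.Adj a v ∨ G.Adj d v := by
  have hv := v.2
  rw [hP.mem_verts] at hv
  push Not at hv
  unfold contract
  rw [map_adj']
  simp only [contractMap_eq_some, contractMap_eq_none, hP.mem_verts]
  constructor
  · rintro ⟨_, u', v', h, rfl | rfl | rfl | rfl, rfl⟩
    · exact Or.inl h
    · exact (((hP.adj_b _).mp h).elim hv.1 hv.2.2.1).elim
    · exact (((hP.adj_c _).mp h).elim hv.2.1 hv.2.2.2).elim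
    · exact Or.inr h
  · rintro (h | h)
    · exact ⟨(Option.some_ne_none v).symm, a, v, h, Or.inl rfl, rfl⟩
    · exact ⟨(Option.some_ne_none v).symm, d, v, h, Or.inr (Or.inr (Or.inr rfl)), rfl⟩

/-! ### Weights sorted by their position relative to the path -/

/-- The weights on the vertices of `G` with the values `α`, `β`, `γ`, `δ` at the vertices
`a`, `b`, `c`, `d` and the values `σ` off the path. -/
noncomputable def pathWeight (a b c d : V) (α β γ δ : ℝ) (σ : {v : V // v ∉ H.verts} →₀ ℝ) :
    V →₀ ℝ :=
  Finsupp.single a α + Finsupp.single b β + Finsupp.single c γ + Finsupp.single d δ +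
    σ.mapDomain Subtype.val

/-- The weights on the vertices of the suspension of `Ind (G / H)` with the values `n`, `s` at the
two poles, `p` at the contracted vertex and `σ` at the vertices off the path. -/
noncomputable def suspensionWeight (n s p : ℝ) (σ : {v : V // v ∉ H.verts} →₀ ℝ) :
    Bool ⊕ Option {v : V // v ∉ H.verts} →₀ ℝ :=
  Finsupp.single (Sum.inl true) n + Finsupp.single (Sum.inl false) s +
    Finsupp.single (Sum.inr none) p + σ.mapDomain (Sum.inr ∘ some)

theorem degree_pathWeight (α β γ δ : ℝ) (σ : {v : V // v ∉ H.verts} →₀ ℝ) :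
    (pathWeight a b c d α β γ δ σ).degree = α + β + γ + δ + σ.degree := by
  simp only [pathWeight, map_add, Finsupp.degree_single, Finsupp.degree_mapDomain]

theorem degree_suspensionWeight (n s p : ℝ) (σ : {v : V // v ∉ H.verts} →₀ ℝ) :
    (suspensionWeight n s p σ).degree = n + s + p + σ.degree := by
  simp only [suspensionWeight, map_add, Finsupp.degree_single, Finsupp.degree_mapDomain]

section suspensionWeight

variable (n s p : ℝ) (σ : {v : V // v ∉ H.verts} →₀ ℝ)

theorem inr_some_injective :
    Function.Injective (Sum.inr ∘ some : {v : V // v ∉ H.verts} → Bool ⊕ Option _) :=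
  Sum.inr_injective.comp (Option.some_injective _)

@[simp]
theorem suspensionWeight_true : suspensionWeight n s p σ (Sum.inl true) = n := by
  simp [suspensionWeight, Finsupp.mapDomain_of_notMem_range]

@[simp]
theorem suspensionWeight_false : suspensionWeight n s p σ (Sum.inl false) = s := by
  simp [suspensionWeight, Finsupp.mapDomain_of_notMem_range]

@[simp]
theorem suspensionWeight_none : suspensionWeight n s p σ (Sum.inr none) = p := by
  simp [suspensionWeight, Finsupp.mapDomain_of_notMem_range]

@[simp]
theorem suspensionWeight_some (v : {v : V // v ∉ H.verts}) :
    suspensionWeight n s p σ (Sum.inr (some v)) = σ v := by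
  have := Finsupp.mapDomain_apply inr_some_injective σ v
  simpa [suspensionWeight] using this

theorem eq_suspensionWeight (w : Bool ⊕ Option {v : V // v ∉ H.verts} →₀ ℝ) :
    w = suspensionWeight (w (Sum.inl true)) (w (Sum.inl false)) (w (Sum.inr none))
      (w.comapDomain (Sum.inr ∘ some) inr_some_injective.injOn) := by
  ext ((_ | _) | _ | v) <;> simp

end suspensionWeight

theorem mapDomain_val_apply_of_mem_verts (σ : {v : V // v ∉ H.verts} →₀ ℝ) {v : V}
    (hv : v ∈ H.verts) : σ.mapDomain Subtype.val v = 0 :=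
  Finsupp.mapDomain_of_notMem_range _ _ (by simpa using hv)

namespace IsThreePath

section pathWeight

variable (α β γ δ : ℝ) (σ : {v : V // v ∉ H.verts} →₀ ℝ)

theorem pathWeight_a (hP : H.IsThreePath a b c d) : pathWeight a b c d α β γ δ σ a = α := by
  have h : a ∈ H.verts := by simp [hP.mem_verts]
  simp [pathWeight, mapDomain_val_apply_of_mem_verts σ h, hP.hab, hP.hac, hP.had]

theorem pathWeight_b (hP : H.IsThreePath a b c d) : pathWeight a b c d α β γ δ σ b = β := by
  have h : b ∈ H.verts := by simp [hP.mem_verts]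
  simp [pathWeight, mapDomain_val_apply_of_mem_verts σ h, hP.hab.symm, hP.hbc, hP.hbd]

theorem pathWeight_c (hP : H.IsThreePath a b c d) : pathWeight a b c d α β γ δ σ c = γ := by
  have h : c ∈ H.verts := by simp [hP.mem_verts]
  simp [pathWeight, mapDomain_val_apply_of_mem_verts σ h, hP.hac.symm, hP.hbc.symm, hP.hcd]

theorem pathWeight_d (hP : H.IsThreePath a b c d) : pathWeight a b c d α β γ δ σ d = δ := by
  have h : d ∈ H.verts := by simp [hP.mem_verts]
  simp [pathWeight, mapDomain_val_apply_of_mem_verts σ h, hP.had.symm, hP.hbd.symm, hP.hcd.symm]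

theorem pathWeight_val (hP : H.IsThreePath a b c d) (v : {v : V // v ∉ H.verts}) :
    pathWeight a b c d α β γ δ σ v = σ v := by
  have hv := v.2
  rw [hP.mem_verts] at hv
  push Not at hv
  simp [pathWeight, Finsupp.mapDomain_apply Subtype.val_injective, hv]

/-- A property holds at all vertices if it holds at the four vertices of the path and off it. -/
theorem forall_iff (hP : H.IsThreePath a b c d) {p : V → Prop} :
    (∀ v, p v) ↔ p a ∧ p b ∧ p c ∧ p d ∧ ∀ v : {v : V // v ∉ H.verts}, p v := by
  refine ⟨fun h => ⟨h _, h _, h _, h _, fun v => h v⟩, fun ⟨h1, h2, h3, h4, h⟩ v => ?_⟩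
  by_cases hv : v ∈ H.verts
  · rcases (hP.mem_verts v).mp hv with rfl | rfl | rfl | rfl <;> assumption
  · exact h ⟨v, hv⟩

theorem eq_pathWeight (hP : H.IsThreePath a b c d) (w : V →₀ ℝ) :
    w = pathWeight a b c d (w a) (w b) (w c) (w d) (w.subtypeDomain fun v => v ∉ H.verts) := by
  rw [DFunLike.ext_iff, hP.forall_iff]
  simp [hP.pathWeight_a, hP.pathWeight_b, hP.pathWeight_c, hP.pathWeight_d, hP.pathWeight_val]

end pathWeight

theorem adj_ab (hP : H.IsThreePath a b c d) : G.Adj a b :=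
  ((hP.adj_b a).mpr (Or.inl rfl)).symm

theorem adj_bc (hP : H.IsThreePath a b c d) : G.Adj b c :=
  (hP.adj_b c).mpr (Or.inr rfl)

theorem adj_cd (hP : H.IsThreePath a b c d) : G.Adj c d :=
  (hP.adj_c d).mpr (Or.inr rfl)

/-- The neighbors of `b` and `c` are known, so adjacent vertices are consecutive on the path, or one
of them is off the path and the other one is `a`, `d` or off the path as well. -/
theorem not_adj_of_weights (hP : H.IsThreePath a b c d) {φ ψ : V → ℝ}
    (hab : φ a = 0 ∨ ψ b = 0) (hba : φ b = 0 ∨ ψ a = 0)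
    (hbc : φ b = 0 ∨ ψ c = 0) (hcb : φ c = 0 ∨ ψ b = 0)
    (hcd : φ c = 0 ∨ ψ d = 0) (hdc : φ d = 0 ∨ ψ c = 0)
    (hav : ∀ v : {v : V // v ∉ H.verts}, φ a ≠ 0 → ψ v ≠ 0 → ¬ G.Adj a v)
    (hva : ∀ v : {v : V // v ∉ H.verts}, φ v ≠ 0 → ψ a ≠ 0 → ¬ G.Adj a v)
    (hdv : ∀ v : {v : V // v ∉ H.verts}, φ d ≠ 0 → ψ v ≠ 0 → ¬ G.Adj d v)
    (hvd : ∀ v : {v : V // v ∉ H.verts}, φ v ≠ 0 → ψ d ≠ 0 → ¬ G.Adj d v)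
    (huv : ∀ u v : {v : V // v ∉ H.verts}, φ u ≠ 0 → ψ v ≠ 0 → ¬ G.Adj u v) :
    ∀ u v, φ u ≠ 0 → ψ v ≠ 0 → ¬ G.Adj u v := by
  have hb : ∀ u, G.Adj u b ↔ u = a ∨ u = c := fun u => by rw [G.adj_comm, hP.adj_b]
  have hc : ∀ u, G.Adj u c ↔ u = b ∨ u = d := fun u => by rw [G.adj_comm, hP.adj_c]
  have hda : ¬ G.Adj d a := fun h => hP.not_adj h.symm
  have hout : ∀ v : {v : V // v ∉ H.verts}, (v : V) ≠ a ∧ (v : V) ≠ b ∧ (v : V) ≠ c ∧ (v : V) ≠ d :=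
    fun v => by simpa [hP.mem_verts] using v.2
  have hav' : ∀ v, φ a ≠ 0 → ψ v ≠ 0 → ¬ G.Adj a v := by
    rw [hP.forall_iff]
    refine ⟨fun _ _ => G.irrefl, ?_, ?_, fun _ _ => hP.not_adj, hav⟩
    · exact fun h h' => absurd hab (by simp [h, h'])
    · simp [hc, hP.hab, hP.had]
  have hbv' : ∀ v, φ b ≠ 0 → ψ v ≠ 0 → ¬ G.Adj b v := by
    intro v h h' hv
    rcases (hP.adj_b v).mp hv with rfl | rfl
    exacts [hba.elim h h', hbc.elim h h']
  have hcv' : ∀ v, φ c ≠ 0 → ψ v ≠ 0 → ¬ G.Adj c v := by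
    intro v h h' hv
    rcases (hP.adj_c v).mp hv with rfl | rfl
    exacts [hcb.elim h h', hcd.elim h h']
  have hdv' : ∀ v, φ d ≠ 0 → ψ v ≠ 0 → ¬ G.Adj d v := by
    rw [hP.forall_iff]
    refine ⟨fun _ _ => hda, ?_, ?_, fun _ _ => G.irrefl, hdv⟩
    · simp [hb, hP.had.symm, hP.hcd.symm]
    · exact fun h h' => absurd hdc (by simp [h, h'])
  rw [hP.forall_iff]
  refine ⟨hav', hbv', hcv', hdv', fun u => ?_⟩
  rw [hP.forall_iff]
  refine ⟨fun h h' hu => hva u h h' hu.symm, ?_, ?_, fun h h' hu => hvd u h h' hu.symm, huv u⟩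
  · simp [hb, hout u]
  · simp [hc, hout u]

/-! ### The maps between the realizations -/

/-- The map from `Ind G` to the suspension. It sends `c` and `a` to one pole and `b` and `d` to the
other one, the midpoint of the edge `{a, d}` to the contracted vertex, fixes the vertices off the
path, and is affine on the simplices once the edge `{a, d}` is subdivided at its midpoint. -/
noncomputable def toSuspension (hP : H.IsThreePath a b c d)
    (x : SimplicialRealization G.independenceComplex) :
    SimplicialRealization (G.contract H).independenceComplex.suspension :=
  let w := suspensionWeight (x.weight c + x.weight a - min (x.weight a) (x.weight d))
    (x.weight b + x.weight d - min (x.weight a) (x.weight d))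
    (2 * min (x.weight a) (x.weight d)) (x.weight.subtypeDomain fun v => v ∉ H.verts)
  have hdeg : w.degree = 1 := by
    rw [← x.degree_weight_eq_one, hP.eq_pathWeight x.weight, degree_pathWeight,
      degree_suspensionWeight]
    ring
  { weight := w
    nonneg := by
      have ha := x.nonneg a
      have hb := x.nonneg b
      have hc := x.nonneg c
      have hd := x.nonneg d
      rintro ((_ | _) | _ | v)
      · rw [suspensionWeight_false]; linarith [min_le_right (x.weight a) (x.weight d)]
      · rw [suspensionWeight_true]; linarith [min_le_left (x.weight a) (x.weight d)]
      · rw [suspensionWeight_none]; positivity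
      · rw [suspensionWeight_some]; exact x.nonneg v
    sum_eq_one := hdeg
    support_mem := by
      have ha := x.nonneg a
      have hd := x.nonneg d
      have hab := weight_eq_zero_or_of_adj x hP.adj_ab
      have hbc := weight_eq_zero_or_of_adj x hP.adj_bc
      have hcd := weight_eq_zero_or_of_adj x hP.adj_cd
      have hmin : ∀ v : {v : V // v ∉ H.verts}, 2 * min (x.weight a) (x.weight d) ≠ 0 →
          x.weight v ≠ 0 → ¬ (G.contract H).Adj none (some v) := by
        intro v hm hv
        rw [hP.contract_adj_none, not_or]
        exact ⟨not_adj_of_weight_ne_zero x (by grind) hv,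
          not_adj_of_weight_ne_zero x (by grind) hv⟩
      rw [mem_faces_suspension_independenceComplex]
      refine ⟨SimplicialRealization.support_nonempty_of_degree hdeg, ?_, ?_⟩
      · simp only [Finsupp.mem_support_iff, w, suspensionWeight_true, suspensionWeight_false]
        grind
      · rintro (_ | u) (_ | v) hu hv
        · exact SimpleGraph.irrefl _
        · simp only [Finsupp.mem_support_iff, w, suspensionWeight_none, suspensionWeight_some,
            Finsupp.subtypeDomain_apply] at hu hv
          exact hmin v hu hv
        · simp only [Finsupp.mem_support_iff, w, suspensionWeight_none, suspensionWeight_some,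
            Finsupp.subtypeDomain_apply] at hu hv
          exact fun h => hmin u hv hu h.symm
        · simp only [Finsupp.mem_support_iff, w, suspensionWeight_some,
            Finsupp.subtypeDomain_apply] at hu hv
          rw [contract_adj_some]
          exact not_adj_of_weight_ne_zero x hu hv }

/-- The map from the suspension to `Ind G`. It sends the poles to `c` and `b`, the contracted vertex
to the midpoint of the edge `{a, d}`, and fixes the vertices off the path. The edge from the
contracted vertex to the pole that is sent to `c` has its midpoint sent to `a`; the midpoint of the
edge to the other pole is sent to `d`.
It is affine on the simplices after the corresponding subdivision; since one of the weights `n`,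
`s` of the poles vanishes, a single formula covers both halves of the suspension. -/
noncomputable def ofSuspension (hP : H.IsThreePath a b c d)
    (y : SimplicialRealization (G.contract H).independenceComplex.suspension) :
    SimplicialRealization G.independenceComplex :=
  let n := y.weight (Sum.inl true)
  let s := y.weight (Sum.inl false)
  let p := y.weight (Sum.inr none)
  let w := pathWeight a b c d ((max (p - s) 0 + 3 * min p n) / 2) (max (s - p) 0) (max (n - p) 0)
    ((max (p - n) 0 + 3 * min p s) / 2)
    (y.weight.comapDomain (Sum.inr ∘ some) inr_some_injective.injOn)
  have hn : 0 ≤ n := y.nonneg _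
  have hs : 0 ≤ s := y.nonneg _
  have hp : 0 ≤ p := y.nonneg _
  have hns : n = 0 ∨ s = 0 := weight_pole_eq_zero_or y
  have hdeg : w.degree = 1 := by
    rw [← y.degree_weight_eq_one, eq_suspensionWeight y.weight, degree_suspensionWeight,
      degree_pathWeight]
    grind
  { weight := w
    nonneg := by
      rw [hP.forall_iff]
      simp only [w, hP.pathWeight_a, hP.pathWeight_b, hP.pathWeight_c, hP.pathWeight_d,
        hP.pathWeight_val]
      exact ⟨by positivity, by positivity, by positivity, by positivity, fun v => y.nonneg _⟩
    sum_eq_one := hdeg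
    support_mem := by
      have hpv : ∀ v : {v : V // v ∉ H.verts}, p ≠ 0 → y.weight (Sum.inr (some v)) ≠ 0 →
          ¬ G.Adj a v ∧ ¬ G.Adj d v := fun v h h' => by
        rw [← not_or, ← hP.contract_adj_none]
        exact not_adj_of_weight_inr_ne_zero y h h'
      rw [mem_faces_independenceComplex]
      refine ⟨SimplicialRealization.support_nonempty_of_degree hdeg, ?_⟩
      simp only [Finsupp.mem_support_iff]
      suffices ∀ u v, w u ≠ 0 → w v ≠ 0 → ¬ G.Adj u v from fun u hu v hv => this u v hu hv
      apply hP.not_adj_of_weights <;>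
        simp only [w, hP.pathWeight_a, hP.pathWeight_b, hP.pathWeight_c, hP.pathWeight_d,
          hP.pathWeight_val, Finsupp.comapDomain_apply, Function.comp_apply]
      · grind
      · grind
      · grind
      · grind
      · grind
      · grind
      · exact fun v h h' => (hpv v (by grind) h').1
      · exact fun v h' h => (hpv v (by grind) h').1
      · exact fun v h h' => (hpv v (by grind) h').2
      · exact fun v h' h => (hpv v (by grind) h').2
      · intro u v hu hv
        rw [← contract_adj_some]
        exact not_adj_of_weight_inr_ne_zero y hu hv }

/-- The self-map of `Ind G` that expands the middle half of the edge `{a, d}` affinely to the whole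
edge and collapses its first and last quarter to `a` and `d`; the same is done on each slice
parallel to this edge, and the other weights are fixed. The amount `e` of weight that is moved from
`d` to `a` is `(α - δ) / 2`, cut off where it would make one of the two weights negative. -/
noncomputable def stretch (hP : H.IsThreePath a b c d)
    (x : SimplicialRealization G.independenceComplex) :
    SimplicialRealization G.independenceComplex :=
  let e := max (-x.weight a) (min (x.weight d) ((x.weight a - x.weight d) / 2))
  let w := pathWeight a b c d (x.weight a + e) (x.weight b) (x.weight c) (x.weight d - e)
    (x.weight.subtypeDomain fun v => v ∉ H.verts)
  have hdeg : w.degree = 1 := by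
    rw [← x.degree_weight_eq_one, hP.eq_pathWeight x.weight, degree_pathWeight, degree_pathWeight]
    ring
  have ha := x.nonneg a
  have hd := x.nonneg d
  have hsupp : w.support ⊆ x.weight.support := by
    intro v
    simp only [Finsupp.mem_support_iff]
    revert v
    rw [hP.forall_iff]
    simp only [w, hP.pathWeight_a, hP.pathWeight_b, hP.pathWeight_c, hP.pathWeight_d,
      hP.pathWeight_val]
    exact ⟨by grind, id, id, by grind, fun v => id⟩
  { weight := w
    nonneg := by
      rw [hP.forall_iff]
      simp only [w, hP.pathWeight_a, hP.pathWeight_b, hP.pathWeight_c, hP.pathWeight_d,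
        hP.pathWeight_val]
      exact ⟨by grind, x.nonneg b, x.nonneg c, by grind, fun v => x.nonneg _⟩
    sum_eq_one := hdeg
    support_mem := (G.independenceComplex.isRelLowerSet_faces x.support_mem).2 hsupp
      (SimplicialRealization.support_nonempty_of_degree hdeg) }

/-- The map `stretch` does not leave the carrier of a point, so that it is homotopic to the
identity. -/
theorem support_stretch_subset (hP : H.IsThreePath a b c d)
    (x : SimplicialRealization G.independenceComplex) :
    (hP.stretch x).weight.support ⊆ x.weight.support := by
  have ha := x.nonneg a
  have hd := x.nonneg d
  intro v
  simp only [Finsupp.mem_support_iff]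
  revert v
  rw [hP.forall_iff]
  simp only [stretch, hP.pathWeight_a, hP.pathWeight_b, hP.pathWeight_c, hP.pathWeight_d,
    hP.pathWeight_val]
  exact ⟨by grind, id, id, by grind, fun v => id⟩

open SimplicialRealization

/-! ### Continuity of the three maps -/

theorem finitelyCarried_toSuspension (hP : H.IsThreePath a b c d) :
    FinitelyCarried hP.toSuspension := by
  classical
  intro s
  refine ⟨{Sum.inl true, Sum.inl false, Sum.inr none} ∪
    (s.subtype fun v => v ∉ H.verts).image (Sum.inr ∘ some), fun x hx => ?_⟩
  rintro ((_ | _) | _ | v) hv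
  · simp
  · simp
  · simp
  · have hv' : x.weight v ≠ 0 := by
      simpa only [toSuspension, Finsupp.mem_support_iff, suspensionWeight_some,
      Finsupp.subtypeDomain_apply] using hv
    have := hx (Finsupp.mem_support_iff.mpr hv')
    simp [this]

theorem finitelyCarried_ofSuspension (hP : H.IsThreePath a b c d) :
    FinitelyCarried hP.ofSuspension := by
  classical
  intro s
  refine ⟨{a, b, c, d} ∪ (s.preimage (Sum.inr ∘ some) inr_some_injective.injOn).image Subtype.val,
    fun y hy => ?_⟩
  suffices ∀ v, (hP.ofSuspension y).weight v ≠ 0 → v ∈ _ from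
    fun v hv => this v (Finsupp.mem_support_iff.mp hv)
  rw [hP.forall_iff]
  refine ⟨by simp, by simp, by simp, by simp, fun v hv => ?_⟩
  have hv' : y.weight (Sum.inr (some v)) ≠ 0 := by
    simpa only [ofSuspension, hP.pathWeight_val, Finsupp.comapDomain_apply,
      Function.comp_apply] using hv
  have := hy (Finsupp.mem_support_iff.mpr hv')
  simp [this, v.2]

theorem continuous_toSuspension (hP : H.IsThreePath a b c d) : Continuous hP.toSuspension := by
  refine hP.finitelyCarried_toSuspension.continuous ?_
  have h : ∀ v, Continuous fun x : SimplicialRealization G.independenceComplex => x.weight v :=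
    continuous_weight
  have ha := h a
  have hb := h b
  have hc := h c
  have hd := h d
  rintro ((_ | _) | _ | v)
  · simp only [toSuspension, suspensionWeight_false]; fun_prop
  · simp only [toSuspension, suspensionWeight_true]; fun_prop
  · simp only [toSuspension, suspensionWeight_none]; fun_prop
  · simp only [toSuspension, suspensionWeight_some]; exact h v

theorem continuous_ofSuspension (hP : H.IsThreePath a b c d) : Continuous hP.ofSuspension := by
  refine hP.finitelyCarried_ofSuspension.continuous ?_
  have h : ∀ v, Continuous fun y : SimplicialRealization
      (G.contract H).independenceComplex.suspension => y.weight v := continuous_weight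
  have hn := h (Sum.inl true)
  have hs := h (Sum.inl false)
  have hp := h (Sum.inr none)
  rw [hP.forall_iff]
  simp only [ofSuspension, hP.pathWeight_a, hP.pathWeight_b, hP.pathWeight_c, hP.pathWeight_d,
    hP.pathWeight_val]
  exact ⟨by fun_prop, by fun_prop, by fun_prop, by fun_prop, fun v => h _⟩

theorem continuous_stretch (hP : H.IsThreePath a b c d) : Continuous hP.stretch := by
  refine (FinitelyCarried.of_support_subset hP.support_stretch_subset).continuous ?_
  have h : ∀ v, Continuous fun x : SimplicialRealization G.independenceComplex => x.weight v :=
    continuous_weight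
  have ha := h a
  have hd := h d
  rw [hP.forall_iff]
  simp only [stretch, hP.pathWeight_a, hP.pathWeight_b, hP.pathWeight_c, hP.pathWeight_d,
    hP.pathWeight_val]
  exact ⟨by fun_prop, h b, h c, by fun_prop, fun v => h v⟩

/-! ### The homotopies -/

/-- The composite on the suspension does not leave the carrier of a point: on the edge from a pole
to the contracted vertex it collapses the half next to the pole and expands the other half. -/
theorem support_toSuspension_ofSuspension_subset (hP : H.IsThreePath a b c d)
    (y : SimplicialRealization (G.contract H).independenceComplex.suspension) :
    (hP.toSuspension (hP.ofSuspension y)).weight.support ⊆ y.weight.support := by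
  have hn := y.nonneg (Sum.inl true)
  have hs := y.nonneg (Sum.inl false)
  have hp := y.nonneg (Sum.inr none)
  have hns := weight_pole_eq_zero_or y
  rintro ((_ | _) | _ | v) <;>
    simp only [Finsupp.mem_support_iff, toSuspension, ofSuspension, suspensionWeight_true,
      suspensionWeight_false, suspensionWeight_none, suspensionWeight_some, hP.pathWeight_a,
      hP.pathWeight_b, hP.pathWeight_c, hP.pathWeight_d, Finsupp.subtypeDomain_apply,
      hP.pathWeight_val]
  · grind
  · grind
  · grind
  · exact id

/-- For weights `α`, `β`, `δ` at `a`, `b`, `d`: the weight that `stretch` gives to `a` vanishes, or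
the one that `ofSuspension ∘ toSuspension` gives to `b` does. -/
theorem stretch_start_eq_zero_or {α β δ : ℝ} (hδ : 0 ≤ δ) (h : α = 0 ∨ β = 0) :
    α + max (-α) (min δ ((α - δ) / 2)) = 0 ∨
      max (β + δ - min α δ - 2 * min α δ) 0 = 0 := by
  rcases le_or_gt (3 * α) δ with h' | h'
  · left
    rw [max_eq_left ((min_le_right _ _).trans (by linarith))]
    ring
  · right
    have hβ : β = 0 := h.resolve_left (by linarith)
    exact max_eq_right (by rcases min_cases α δ with h | h <;> linarith)

/-- For weights `α`, `γ`, `δ` at `a`, `c`, `d`: the weight that `stretch` gives to `d` vanishes, or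
the one that `ofSuspension ∘ toSuspension` gives to `c` does. -/
theorem stretch_end_eq_zero_or {α γ δ : ℝ} (hα : 0 ≤ α) (hδ : 0 ≤ δ) (h : γ = 0 ∨ δ = 0) :
    δ - max (-α) (min δ ((α - δ) / 2)) = 0 ∨
      max (γ + α - min α δ - 2 * min α δ) 0 = 0 := by
  rcases le_or_gt (3 * δ) α with h' | h'
  · left
    rw [min_eq_left (by linarith), max_eq_right (by linarith)]
    ring
  · right
    have hγ : γ = 0 := h.resolve_right (by linarith)
    exact max_eq_right (by rcases min_cases α δ with h | h <;> linarith)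

open Classical in
/-- The composite on `Ind G` sends the middle half of the edge `{a, d}` to this edge in the same way
as `stretch`, its first quarter to the edge `{a, c}` and its last quarter to `{b, d}`, where
`stretch` has the values `a` and `d`. -/
theorem support_stretch_union_mem_faces (hP : H.IsThreePath a b c d)
    (x : SimplicialRealization G.independenceComplex) :
    (hP.stretch x).weight.support ∪ (hP.ofSuspension (hP.toSuspension x)).weight.support ∈
      G.independenceComplex.faces := by
  have key : ∀ u v, (hP.stretch x).weight u ≠ 0 →
      (hP.ofSuspension (hP.toSuspension x)).weight v ≠ 0 → ¬ G.Adj u v := by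
    have ha := x.nonneg a
    have hb := x.nonneg b
    have hc := x.nonneg c
    have hd := x.nonneg d
    have hab := weight_eq_zero_or_of_adj x hP.adj_ab
    have hbc := weight_eq_zero_or_of_adj x hP.adj_bc
    have hcd := weight_eq_zero_or_of_adj x hP.adj_cd
    have hb0 : x.weight b = 0 ∨ x.weight a = 0 ∧ x.weight c = 0 := by tauto
    have hc0 : x.weight c = 0 ∨ x.weight b = 0 ∧ x.weight d = 0 := by tauto
    apply hP.not_adj_of_weights <;>
      simp only [stretch, toSuspension, ofSuspension, suspensionWeight_true,
        suspensionWeight_false, suspensionWeight_none, suspensionWeight_some, hP.pathWeight_a,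
        hP.pathWeight_b, hP.pathWeight_c, hP.pathWeight_d, hP.pathWeight_val,
        Finsupp.comapDomain_apply, Function.comp_apply, Finsupp.subtypeDomain_apply]
    · exact stretch_start_eq_zero_or hd hab
    · refine hb0.imp_right fun ⟨h, h'⟩ => ?_
      simpa [h, h', hd] using by linarith
    · refine hb0.imp_right fun ⟨h, h'⟩ => ?_
      simp [h, h', hd]
    · refine hc0.imp_right fun ⟨h, h'⟩ => ?_
      simp [h, h', ha]
    · refine hc0.imp_right fun ⟨h, h'⟩ => ?_
      simpa [h, h', ha] using by linarith
    · exact stretch_end_eq_zero_or ha hd hcd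
    · exact fun v h h' => not_adj_of_weight_ne_zero x (by grind) h'
    · exact fun v h' h => not_adj_of_weight_ne_zero x (by grind) h'
    · exact fun v h h' => not_adj_of_weight_ne_zero x (by grind) h'
    · exact fun v h' h => not_adj_of_weight_ne_zero x (by grind) h'
    · exact fun u v hu hv => not_adj_of_weight_ne_zero x hu hv
  rw [mem_faces_independenceComplex]
  simp only [Finset.mem_union, Finsupp.mem_support_iff]
  refine ⟨(support_nonempty_of_degree (degree_weight_eq_one _)).inl, ?_⟩
  rintro u (hu | hu) v (hv | hv)
  · exact not_adj_of_weight_ne_zero _ hu hv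
  · exact key u v hu hv
  · exact fun h => key v u hv hu h.symm
  · exact not_adj_of_weight_ne_zero _ hu hv

theorem nonempty_homotopyEquiv (hP : H.IsThreePath a b c d) :
    Nonempty (SimplicialRealization G.independenceComplex ≃ₕ
      SimplicialRealization (G.contract H).independenceComplex.suspension) := by
  let f : C(SimplicialRealization G.independenceComplex,
      SimplicialRealization (G.contract H).independenceComplex.suspension) :=
    ⟨hP.toSuspension, hP.continuous_toSuspension⟩
  let g : C(SimplicialRealization (G.contract H).independenceComplex.suspension,
      SimplicialRealization G.independenceComplex) :=
    ⟨hP.ofSuspension, hP.continuous_ofSuspension⟩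
  let r : C(SimplicialRealization G.independenceComplex,
      SimplicialRealization G.independenceComplex) :=
    ⟨hP.stretch, hP.continuous_stretch⟩
  have hr : FinitelyCarried r := .of_support_subset hP.support_stretch_subset
  have hgf : (g.comp f).Homotopic r :=
    (homotopic_of_union_mem_faces r (g.comp f) hr
      (hP.finitelyCarried_ofSuspension.comp hP.finitelyCarried_toSuspension)
      hP.support_stretch_union_mem_faces).symm
  exact ⟨f, g,
    hgf.trans (homotopic_id_of_support_subset r hP.support_stretch_subset),
    homotopic_id_of_support_subset (f.comp g) hP.support_toSuspension_ofSuspension_subset⟩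

end IsThreePath
end Subgraph

/-! ### Paths with three edges -/

theorem Walk.IsPath.exists_isThreePath {a d : V} {P : G.Walk a d} (hP : P.IsPath)
    (hlen : P.length = 3)
    (hdeg : ∀ v ∈ P.support, v ≠ a → v ≠ d → (G.neighborSet v).encard = 2)
    (had : ¬ G.Adj a d) : ∃ b c, P.toSubgraph.IsThreePath a b c d := by
  have key : ∀ v x y : V, x ≠ y → (G.neighborSet v).encard = 2 → G.Adj v x → G.Adj v y →
      ∀ z, G.Adj v z ↔ z = x ∨ z = y := by
    intro v x y hxy hv hx hy z
    have hsub : ({x, y} : Set V) ⊆ G.neighborSet v := by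
      rintro z (rfl | rfl)
      exacts [hx, hy]
    have heq := (Set.toFinite {x, y}).eq_of_subset_of_encard_le hsub
      (by rw [hv, Set.encard_pair hxy])
    rw [← mem_neighborSet, ← heq]
    simp
  obtain _ | @⟨_, b, _, hab, P⟩ := P
  · simp at hlen
  obtain _ | @⟨_, c, _, hbc, P⟩ := P
  · simp at hlen
  obtain _ | @⟨_, e, _, hcd, P⟩ := P
  · simp at hlen
  obtain _ | _ := P
  swap
  · simp at hlen
  simp only [Walk.cons_isPath_iff, Walk.support_cons, Walk.support_nil, List.mem_cons,
    List.not_mem_nil, or_false, not_or] at hP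
  obtain ⟨⟨⟨_, hcd'⟩, hbc', hbd'⟩, hab', hac', had'⟩ := hP
  refine ⟨b, c, ?_, hab', hac', had', hbc', hbd', hcd', ?_, ?_, had⟩
  · intro v
    simp
    tauto
  · exact key b a c hac' (hdeg b (by simp) (Ne.symm hab') hbd') hab.symm hbc
  · exact key c b d hbd' (hdeg c (by simp) (Ne.symm hac') hcd') hbc.symm hcd

end SimpleGraph

theorem mainTheorem2 {V : Type*} (G : SimpleGraph V) {a d : V} (P : G.Walk a d)
    (hP : P.IsPath) (hlen : P.length = 3)
    (hdeg : ∀ v ∈ P.support, v ≠ a → v ≠ d → (G.neighborSet v).encard = 2)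
    (had : ¬ G.Adj a d) :
    Nonempty (SimplicialRealization G.independenceComplex ≃ₕ
      SimplicialRealization (G.contract P.toSubgraph).independenceComplex.suspension) := by
  obtain ⟨b, c, h⟩ := hP.exists_isThreePath hlen hdeg had
  exact h.nonempty_homotopyEquiv
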